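/- Let $\mathrm{SU}(2,1)$ be the group of complex $3\times 3$ matrices of determinant $1$ that preserve the Hermitian form $\langle z,w\rangle = z_1\overline{w_1}+z_2\overline{w_2}-z_3\overline{w_3}$ on $\mathbb{C}^3$. Write $t_M$ for the trace of a matrix $M$ and $[A,B]=ABA^{-1}B^{-1}$. For every word $w$ in two letters and their inverses (an element of the free group of rank two) there is a polynomial $P_w$ in ten variables with complex coefficients, depending only on $w$, such that for all $A,B\in\mathrm{SU}(2,1)$ $$t_{w(A,B)} = P_w\bigl(t_A,\,t_B,\,t_{AB},\,t_{A^{-1}B},\,t_{[A,B]},\;\overline{t_A},\,\overline{t_B},\,\overline{t_{AB}},\,\overline{t_{A^{-1}B}},\,\overline{t_{[A,B]}}\bigr).$$ -/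

import Mathlib

open Matrix

/-- The Gram matrix `diag(1, 1, -1)` of the standard Hermitian form
`⟨z, w⟩ = z₁ w̄₁ + z₂ w̄₂ - z₃ w̄₃` of signature `(2,1)` on `ℂ³`. -/
def formJ : Matrix (Fin 3) (Fin 3) ℂ := Matrix.diagonal ![1, 1, -1]

/-- The group `SU(2,1)`: complex `3 × 3` matrices of determinant `1` that preserve the standard
Hermitian form of signature `(2,1)`. -/
def SU21 : Subgroup (Matrix.SpecialLinearGroup (Fin 3) ℂ) where
  carrier := {A | (A : Matrix (Fin 3) (Fin 3) ℂ)ᴴ * formJ * (A : Matrix (Fin 3) (Fin 3) ℂ) = formJ}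
  one_mem' := by simp
  mul_mem' := by
    intro A B hA hB
    simp only [Set.mem_ofPred_eq, Matrix.SpecialLinearGroup.coe_mul,
      Matrix.conjTranspose_mul] at hA hB ⊢
    calc (B : Matrix (Fin 3) (Fin 3) ℂ)ᴴ * (A : Matrix (Fin 3) (Fin 3) ℂ)ᴴ * formJ *
          ((A : Matrix (Fin 3) (Fin 3) ℂ) * (B : Matrix (Fin 3) (Fin 3) ℂ))
        = (B : Matrix (Fin 3) (Fin 3) ℂ)ᴴ * ((A : Matrix (Fin 3) (Fin 3) ℂ)ᴴ * formJ *
          (A : Matrix (Fin 3) (Fin 3) ℂ)) * (B : Matrix (Fin 3) (Fin 3) ℂ) := by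
          simp only [Matrix.mul_assoc]
      _ = formJ := by rw [hA, hB]
  inv_mem' := by
    intro A hA
    simp only [Set.mem_ofPred_eq] at hA ⊢
    have h : (A : Matrix (Fin 3) (Fin 3) ℂ) * ((A⁻¹ : Matrix.SpecialLinearGroup (Fin 3) ℂ) :
        Matrix (Fin 3) (Fin 3) ℂ) = 1 := by
      rw [← Matrix.SpecialLinearGroup.coe_mul, mul_inv_cancel, Matrix.SpecialLinearGroup.coe_one]
    generalize ((A⁻¹ : Matrix.SpecialLinearGroup (Fin 3) ℂ) : Matrix (Fin 3) (Fin 3) ℂ) = C at h ⊢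
    have h' : Cᴴ * (A : Matrix (Fin 3) (Fin 3) ℂ)ᴴ = 1 := by
      rw [← Matrix.conjTranspose_mul, h, Matrix.conjTranspose_one]
    calc Cᴴ * formJ * C
        = Cᴴ * ((A : Matrix (Fin 3) (Fin 3) ℂ)ᴴ * formJ * (A : Matrix (Fin 3) (Fin 3) ℂ)) * C := by
          rw [hA]
      _ = (Cᴴ * (A : Matrix (Fin 3) (Fin 3) ℂ)ᴴ) * formJ *
          ((A : Matrix (Fin 3) (Fin 3) ℂ) * C) := by simp only [Matrix.mul_assoc]
      _ = formJ := by rw [h, h', Matrix.one_mul, Matrix.mul_one]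

/-- The trace `t_A` of the matrix `A ∈ SU(2,1)`. -/
def tr21 (A : SU21) : ℂ :=
  Matrix.trace ((A : Matrix.SpecialLinearGroup (Fin 3) ℂ) : Matrix (Fin 3) (Fin 3) ℂ)

/-- The five traces `t_A, t_B, t_{AB}, t_{A⁻¹B}, t_{[A,B]}`, where `[A,B] = A B A⁻¹ B⁻¹`. -/
def fiveTraces (A B : SU21) : Fin 5 → ℂ :=
  ![tr21 A, tr21 B, tr21 (A * B), tr21 (A⁻¹ * B), tr21 (A * B * A⁻¹ * B⁻¹)]

/-! Work over the ring of functions on SU(2,1) × SU(2,1), with `T` the subalgebra generated by the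
ten trace functions. Membership in `T` is exactly expressibility by one polynomial valid for all
pairs. Preservation of the form makes the trace of an inverse the conjugate trace (`tr21_inv`), so
`T` also contains the traces of the inverses of the five basic elements.

Two facts carry the argument. By Cayley–Hamilton a square trades for an inverse modulo shorter
words, which puts the traces of all positive words of length at most 6 in `T`
(`trace_wordProd_mem`); the commutator and its inverse are needed only in degree 6. The polarized
Cayley–Hamilton identity makes x²w + xwx + wx² a combination of shorter words, and in the free
algebra on two letters such elements generate everything in degree 6: the Nagata–Higman phenomenon
for nil index 3 (`KillsPolarizedCubes.vanish`).

Hence the `T`-span of positive words of length at most 5 absorbs length 6 and is closed under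
products. It contains the inverses of the letters, hence every group word, and all its elements have
trace in `T`. -/

/-! ### Cayley–Hamilton identities for 3 × 3 matrices -/

section MatrixIdentities

variable {S : Type*} [CommRing S]

/-- Cayley–Hamilton with one factor of `X` cancelled; the trace of the adjugate is the second
coefficient of the characteristic polynomial. -/
lemma adjugate_fin_three_eq_sq (X : Matrix (Fin 3) (Fin 3) S) :
    X.adjugate = X * X - X.trace • X + X.adjugate.trace • (1 : Matrix (Fin 3) (Fin 3) S) := by
  rw [Matrix.adjugate_fin_three]
  ext i j
  fin_cases i <;> fin_cases j <;>
    simp [Matrix.trace, Fin.sum_univ_three, Matrix.mul_apply] <;> ring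

/-- The derivative of the Cayley–Hamilton identity at `X` in the direction `W`. -/
lemma polarized_cayley_hamilton_fin_three (X W : Matrix (Fin 3) (Fin 3) S) :
    X * X * W + X * W * X + W * X * X =
      X.trace • (X * W) + X.trace • (W * X) + W.trace • (X * X) - X.adjugate.trace • W
        - (X.trace * W.trace - (X * W).trace) • X
        + ((X * X * W).trace - X.trace * (X * W).trace + X.adjugate.trace * W.trace) •
          (1 : Matrix (Fin 3) (Fin 3) S) := by
  rw [Matrix.adjugate_fin_three]
  ext i j
  fin_cases i <;> fin_cases j <;>
    simp [Matrix.trace, Fin.sum_univ_three, Matrix.mul_apply] <;> ring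

lemma sq_eq_of_det_eq_one {X X' : Matrix (Fin 3) (Fin 3) S} (hdet : X.det = 1) (h : X * X' = 1) :
    X * X = X.trace • X - X'.trace • (1 : Matrix (Fin 3) (Fin 3) S) + X' := by
  have hX : X' = X.adjugate := by
    calc X' = (X.adjugate * X) * X' := by rw [adjugate_mul, hdet, one_smul, one_mul]
      _ = X.adjugate := by rw [mul_assoc, h, mul_one]
  rw [hX]
  calc X * X = X.trace • X - X.adjugate.trace • (1 : Matrix (Fin 3) (Fin 3) S) +
        (X * X - X.trace • X + X.adjugate.trace • (1 : Matrix (Fin 3) (Fin 3) S)) := by abel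
    _ = _ := by rw [← adjugate_fin_three_eq_sq X]

lemma adjugate_trace_of_det_eq_one {X X' : Matrix (Fin 3) (Fin 3) S} (hdet : X.det = 1)
    (h : X * X' = 1) : X.adjugate.trace = X'.trace := by
  congr 1
  calc X.adjugate = X.adjugate * (X * X') := by rw [h, mul_one]
    _ = X' := by rw [← mul_assoc, adjugate_mul, hdet, one_smul, one_mul]

end MatrixIdentities

/-! ### Traces of short positive words -/

section TraceMembership

variable {S : Type*} [CommRing S] [Algebra ℂ S]

/-- `X` is a `3 × 3` matrix of determinant one with inverse `X'`, and the traces of both lie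
in the subalgebra `T`. -/
structure UnimodularTraceIn (T : Subalgebra ℂ S) (X X' : Matrix (Fin 3) (Fin 3) S) : Prop where
  det_eq : X.det = 1
  mul_inv : X * X' = 1
  trace_mem : X.trace ∈ T
  trace_inv_mem : X'.trace ∈ T

variable {T : Subalgebra ℂ S} {X X' Y Y' V W Z : Matrix (Fin 3) (Fin 3) S}

namespace UnimodularTraceIn

lemma inv_mul (h : UnimodularTraceIn T X X') : X' * X = 1 :=
  mul_eq_one_comm.mp h.mul_inv

lemma symm (h : UnimodularTraceIn T X X') : UnimodularTraceIn T X' X where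
  det_eq := by simpa [h.det_eq] using congrArg Matrix.det h.mul_inv
  mul_inv := h.inv_mul
  trace_mem := h.trace_inv_mem
  trace_inv_mem := h.trace_mem

lemma mul (hX : UnimodularTraceIn T X X') (hY : UnimodularTraceIn T Y Y')
    (h : (X * Y).trace ∈ T) (h' : (Y' * X').trace ∈ T) :
    UnimodularTraceIn T (X * Y) (Y' * X') where
  det_eq := by rw [det_mul, hX.det_eq, hY.det_eq, one_mul]
  mul_inv := by rw [mul_assoc, ← mul_assoc Y, hY.mul_inv, one_mul, hX.mul_inv]
  trace_mem := h
  trace_inv_mem := h'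

/-- Cayley–Hamilton gives X² = X⁻¹ modulo terms whose traces against `V` are already in `T`. This
exchange of squares and inverses is used in both directions. -/
lemma trace_sq_mul_mem_iff (h : UnimodularTraceIn T X X') (hV : V.trace ∈ T)
    (hXV : (X * V).trace ∈ T) : (X * (X * V)).trace ∈ T ↔ (X' * V).trace ∈ T := by
  have e : (X * (X * V)).trace
      = (X.trace * (X * V).trace - X'.trace * V.trace) + (X' * V).trace := by
    rw [← mul_assoc, sq_eq_of_det_eq_one h.det_eq h.mul_inv]
    simp [add_mul, sub_mul]
  have hm := T.sub_mem (T.mul_mem h.trace_mem hXV) (T.mul_mem h.trace_inv_mem hV)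
  rw [e]
  exact ⟨fun k => by simpa using T.sub_mem k hm, fun k => T.add_mem hm k⟩

lemma trace_cube_mul_mem (h : UnimodularTraceIn T X X') (hV : V.trace ∈ T)
    (hXV : (X * V).trace ∈ T) (hXXV : (X * (X * V)).trace ∈ T) :
    (X * (X * (X * V))).trace ∈ T := by
  rw [h.trace_sq_mul_mem_iff hXV hXXV, ← mul_assoc, h.inv_mul, one_mul]
  exact hV

lemma trace_one_mem : (1 : Matrix (Fin 3) (Fin 3) S).trace ∈ T := by
  simp

lemma trace_sq_mem (h : UnimodularTraceIn T X X') : (X * X).trace ∈ T := by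
  simpa using (h.trace_sq_mul_mem_iff (V := 1) trace_one_mem (by simpa using h.trace_mem)).mpr
    (by simpa using h.trace_inv_mem)

lemma trace_cube_mem (h : UnimodularTraceIn T X X') : (X * (X * X)).trace ∈ T := by
  simpa using h.trace_cube_mul_mem (V := 1) trace_one_mem (by simpa using h.trace_mem)
    (by simpa using h.trace_sq_mem)

lemma trace_polarized_mem (h : UnimodularTraceIn T X X') (hW : W.trace ∈ T) (hZ : Z.trace ∈ T)
    (hXW : (X * W).trace ∈ T) (hXZ : (X * Z).trace ∈ T) (hWZ : (W * Z).trace ∈ T)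
    (hXXW : (X * X * W).trace ∈ T) (hXXZ : (X * X * Z).trace ∈ T)
    (hXWZ : (X * W * Z).trace ∈ T) (hWXZ : (W * X * Z).trace ∈ T) :
    (X * X * W * Z).trace + (X * W * X * Z).trace + (W * X * X * Z).trace ∈ T := by
  have e := congrArg (fun A => (A * Z).trace) (polarized_cayley_hamilton_fin_three X W)
  rw [adjugate_trace_of_det_eq_one h.det_eq h.mul_inv] at e
  simp only [add_mul, sub_mul, Matrix.trace_add, Matrix.trace_sub, Matrix.smul_mul,
    Matrix.trace_smul, smul_eq_mul, one_mul] at e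
  rw [e]
  have hX := h.trace_mem
  have hX' := h.trace_inv_mem
  apply_rules [T.add_mem, T.sub_mem, T.mul_mem]

end UnimodularTraceIn

/-- A pair of unimodular matrices, with inverses, whose basic traces lie in `T`. -/
structure BasicTracesIn (T : Subalgebra ℂ S) (X X' Y Y' : Matrix (Fin 3) (Fin 3) S) : Prop where
  left : UnimodularTraceIn T X X'
  right : UnimodularTraceIn T Y Y'
  mul_mem : (X * Y).trace ∈ T
  inv_mul_inv_mem : (X' * Y').trace ∈ T
  inv_mul_mem : (X' * Y).trace ∈ T
  mul_inv_mem : (X * Y').trace ∈ T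
  comm_mem : (X * (Y * (X' * Y'))).trace ∈ T
  comm_mem' : (Y * (X * (Y' * X'))).trace ∈ T

namespace BasicTracesIn

lemma swap (h : BasicTracesIn T X X' Y Y') : BasicTracesIn T Y Y' X X' where
  left := h.right
  right := h.left
  mul_mem := by rw [trace_mul_comm]; exact h.mul_mem
  inv_mul_inv_mem := by rw [trace_mul_comm]; exact h.inv_mul_inv_mem
  inv_mul_mem := by rw [trace_mul_comm]; exact h.mul_inv_mem
  mul_inv_mem := by rw [trace_mul_comm]; exact h.inv_mul_mem
  comm_mem := h.comm_mem'
  comm_mem' := h.comm_mem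

lemma unimodular_mul (h : BasicTracesIn T X X' Y Y') :
    UnimodularTraceIn T (X * Y) (Y' * X') :=
  h.left.mul h.right h.mul_mem h.swap.inv_mul_inv_mem

lemma trace_xxy (h : BasicTracesIn T X X' Y Y') : (X * (X * Y)).trace ∈ T :=
  (h.left.trace_sq_mul_mem_iff h.right.trace_mem h.mul_mem).mpr h.inv_mul_mem

lemma trace_xyy (h : BasicTracesIn T X X' Y Y') : (X * (Y * Y)).trace ∈ T := by
  rw [trace_mul_comm, mul_assoc]
  exact h.swap.trace_xxy

lemma trace_xyx (h : BasicTracesIn T X X' Y Y') : (X * (Y * X)).trace ∈ T := by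
  rw [trace_mul_comm, mul_assoc]
  exact h.swap.trace_xyy

lemma trace_xxyy (h : BasicTracesIn T X X' Y Y') : (X * (X * (Y * Y))).trace ∈ T := by
  rw [h.left.trace_sq_mul_mem_iff h.right.trace_sq_mem h.trace_xyy, trace_mul_comm, mul_assoc,
    h.right.trace_sq_mul_mem_iff h.left.trace_inv_mem h.swap.mul_inv_mem]
  exact h.swap.inv_mul_inv_mem

lemma trace_xyxy (h : BasicTracesIn T X X' Y Y') : (X * (Y * (X * Y))).trace ∈ T := by
  simpa only [mul_assoc] using h.unimodular_mul.trace_sq_mem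

lemma trace_xxxy (h : BasicTracesIn T X X' Y Y') : (X * (X * (X * Y))).trace ∈ T :=
  h.left.trace_cube_mul_mem h.right.trace_mem h.mul_mem h.trace_xxy

lemma trace_yxxy (h : BasicTracesIn T X X' Y Y') : (Y * (X * (X * Y))).trace ∈ T := by
  rw [trace_mul_comm]
  simpa only [mul_assoc] using h.trace_xxyy

/-- Polarization with W = Y and Z = XY produces three words: two are rotations of each other and the
third contains a cube. Dividing by 2 isolates the repeated one. -/
lemma trace_xxyxy (h : BasicTracesIn T X X' Y Y') : (X * (X * (Y * (X * Y)))).trace ∈ T := by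
  have hyxxxy : (Y * (X * (X * (X * Y)))).trace ∈ T := by
    rw [trace_mul_comm]
    simp only [mul_assoc]
    exact h.left.trace_cube_mul_mem h.right.trace_sq_mem h.trace_xyy h.trace_xxyy
  have e : (X * (Y * (X * (X * Y)))).trace = (X * (X * (Y * (X * Y)))).trace := by
    rw [← mul_assoc X Y, trace_mul_comm]
    simp only [mul_assoc]
  have key := h.left.trace_polarized_mem (W := Y) (Z := X * Y) h.right.trace_mem h.mul_mem
    h.mul_mem h.trace_xxy h.swap.trace_xyx (by simpa only [mul_assoc] using h.trace_xxy)
    (by simpa only [mul_assoc] using h.trace_xxxy) (by simpa only [mul_assoc] using h.trace_xyxy)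
    (by simpa only [mul_assoc] using h.trace_yxxy)
  simp only [mul_assoc] at key
  rw [e] at key
  have h2 := T.smul_mem (T.sub_mem key hyxxxy) (1 / 2 : ℂ)
  rw [add_sub_cancel_right, ← two_smul ℂ, smul_smul] at h2
  norm_num at h2
  exact h2

lemma trace_xxyxxy (h : BasicTracesIn T X X' Y Y') :
    (X * (X * (Y * (X * (X * Y))))).trace ∈ T := by
  have hxx := h.left.mul h.left h.left.trace_sq_mem h.left.symm.trace_sq_mem
  have hxxy := hxx.mul h.right (by simpa only [mul_assoc] using h.trace_xxy) (by
    rw [trace_mul_comm, mul_assoc,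
      h.left.symm.trace_sq_mul_mem_iff h.right.trace_inv_mem h.inv_mul_inv_mem]
    exact h.mul_inv_mem)
  simpa only [mul_assoc] using hxxy.trace_sq_mem

lemma trace_inv_yxy (h : BasicTracesIn T X X' Y Y') : (X' * (Y * (X * Y))).trace ∈ T :=
  (h.left.trace_sq_mul_mem_iff h.swap.trace_xyx h.trace_xyxy).mp h.trace_xxyxy

lemma trace_xyxyy (h : BasicTracesIn T X X' Y Y') : (X * (Y * (X * (Y * Y)))).trace ∈ T := by
  rw [← mul_assoc Y X, ← mul_assoc X, trace_mul_comm]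
  simpa only [mul_assoc] using h.swap.trace_xxyxy

lemma trace_xyyxy (h : BasicTracesIn T X X' Y Y') : (X * (Y * (Y * (X * Y)))).trace ∈ T := by
  rw [trace_mul_comm]
  simpa only [mul_assoc] using h.swap.trace_xxyxy

lemma trace_yxyy (h : BasicTracesIn T X X' Y Y') : (Y * (X * (Y * Y))).trace ∈ T := by
  rw [← mul_assoc, trace_mul_comm]
  simpa only [mul_assoc] using h.swap.trace_xxxy

lemma trace_yyxy (h : BasicTracesIn T X X' Y Y') : (Y * (Y * (X * Y))).trace ∈ T := by
  rw [trace_mul_comm]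
  simpa only [mul_assoc] using h.trace_yxyy

/-- Trading X² and then Y² for inverses leaves a rotation of the commutator of `Y` and `X`. The same
exchange in `trace_xxyyxy` leaves the inverse commutator. -/
lemma trace_xxyxyy (h : BasicTracesIn T X X' Y Y') :
    (X * (X * (Y * (X * (Y * Y))))).trace ∈ T := by
  rw [h.left.trace_sq_mul_mem_iff h.trace_yxyy h.trace_xyxyy]
  have e : (X' * (Y * (X * (Y * Y)))).trace = (Y * (Y * (X' * (Y * X)))).trace := by
    rw [← mul_assoc Y X, ← mul_assoc X', trace_mul_comm]
    simp only [mul_assoc]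
  rw [e, h.right.trace_sq_mul_mem_iff]
  · rw [← mul_assoc, trace_mul_comm]
    simpa only [mul_assoc] using h.swap.comm_mem
  · rw [trace_mul_comm, mul_assoc, h.left.mul_inv, mul_one]
    exact h.right.trace_mem
  · rw [trace_mul_comm]
    simpa only [mul_assoc, trace_mul_comm Y] using h.trace_inv_yxy

lemma trace_xxyyxy (h : BasicTracesIn T X X' Y Y') :
    (X * (X * (Y * (Y * (X * Y))))).trace ∈ T := by
  rw [h.left.trace_sq_mul_mem_iff h.trace_yyxy h.trace_xyyxy, trace_mul_comm]
  simp only [mul_assoc]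
  rw [h.right.trace_sq_mul_mem_iff]
  · rw [trace_mul_comm]
    simpa only [mul_assoc] using h.comm_mem
  · rw [trace_mul_comm, mul_assoc, h.left.inv_mul, mul_one]
    exact h.right.trace_mem
  · rw [← mul_assoc X, ← mul_assoc, trace_mul_comm]
    exact h.trace_inv_yxy

lemma trace_xyxyxy (h : BasicTracesIn T X X' Y Y') :
    (X * (Y * (X * (Y * (X * Y))))).trace ∈ T := by
  simpa only [mul_assoc] using h.unimodular_mul.trace_cube_mem

end BasicTracesIn

end TraceMembership

/-! ### Nilpotency in degree six from nil index three -/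

section NilIndexThree

/-- A function on words that kills the degree six part of the two-sided ideal generated by the
elements `x²w + xwx + wx²`, for a letter `x` and a nonempty word `w`. -/
def KillsPolarizedCubes (f : List Bool → ℂ) : Prop :=
  ∀ (u : List Bool) (x : Bool) (w v : List Bool), w ≠ [] → u.length + w.length + v.length = 4 →
    f (u ++ (x :: x :: w) ++ v) + f (u ++ (x :: w ++ [x]) ++ v) + f (u ++ (w ++ [x, x]) ++ v) = 0

namespace KillsPolarizedCubes

variable {f : List Bool → ℂ}

lemma cube_left (h : KillsPolarizedCubes f) (a x y z : Bool) : f [a, a, a, x, y, z] = 0 := by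
  have e := h [] a [a] [x, y, z] (by simp) rfl
  simp only [List.cons_append, List.nil_append] at e
  linear_combination e / 3

lemma cube_mid (h : KillsPolarizedCubes f) (a x y z : Bool) : f [x, a, a, a, y, z] = 0 := by
  have e := h [x] a [a] [y, z] (by simp) rfl
  simp only [List.cons_append, List.nil_append] at e
  linear_combination e / 3

lemma cube_mid' (h : KillsPolarizedCubes f) (a x y z : Bool) : f [x, y, a, a, a, z] = 0 := by
  have e := h [x, y] a [a] [z] (by simp) rfl
  simp only [List.cons_append, List.nil_append] at e
  linear_combination e / 3

lemma cube_right (h : KillsPolarizedCubes f) (a x y z : Bool) : f [x, y, z, a, a, a] = 0 := by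
  have e := h [x, y, z] a [a] [] (by simp) rfl
  simp only [List.cons_append, List.nil_append] at e
  linear_combination e / 3

/-- The two relations share the words abbaba and bbaaba, so their difference leaves only bababa. -/
lemma vanish_bababa (h : KillsPolarizedCubes f) (a b : Bool) : f [b, a, b, a, b, a] = 0 := by
  have e0 := h [] b [a] [a, b, a] (by simp) rfl
  have e1 := h [] a [b, b] [b, a] (by simp) rfl
  simp only [List.cons_append, List.nil_append, h.cube_mid'] at e0 e1
  linear_combination e0 - e1

/-- Once cubes and alternating words are removed, the combination of five relations collapses to -3
times this value. -/
lemma vanish_bbabaa (h : KillsPolarizedCubes f) (a b : Bool) : f [b, b, a, b, a, a] = 0 := by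
  have e0 := h [] a [b, a, b, b] [] (by simp) rfl
  have e1 := h [] a [b, a, b] [b] (by simp) rfl
  have e2 := h [] b [a, b, a] [a] (by simp) rfl
  have e3 := h [b, a] b [a, a] [] (by simp) rfl
  have e4 := h [] b [b, a] [a, a] (by simp) rfl
  simp only [List.cons_append, List.nil_append, List.append_nil, h.vanish_bababa b a,
    h.vanish_bababa a b, h.cube_mid, h.cube_left] at e0 e1 e2 e3 e4
  linear_combination -(e0 - e1 - e2 + e3 - 2 * e4) / 3

/-- From here on each word is the sole surviving term of a single relation. -/
lemma vanish_ababba (h : KillsPolarizedCubes f) (a b : Bool) : f [a, b, a, b, b, a] = 0 := by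
  have e0 := h [] b [a, b, a] [a] (by simp) rfl
  simp only [List.cons_append, List.nil_append, h.vanish_bbabaa a b, h.vanish_bababa a b] at e0
  simpa using e0

lemma vanish_babbaa (h : KillsPolarizedCubes f) (a b : Bool) : f [b, a, b, b, a, a] = 0 := by
  have e0 := h [] b [b, a] [a, a] (by simp) rfl
  simp only [List.cons_append, List.nil_append, h.cube_left, h.vanish_bbabaa a b] at e0
  simpa using e0

lemma vanish_abbaab (h : KillsPolarizedCubes f) (a b : Bool) : f [a, b, b, a, a, b] = 0 := by
  have e0 := h [] b [a] [a, a, b] (by simp) rfl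
  simp only [List.cons_append, List.nil_append, h.cube_mid', h.vanish_ababba b a] at e0
  simpa using e0

lemma vanish_aabbaa (h : KillsPolarizedCubes f) (a b : Bool) : f [a, a, b, b, a, a] = 0 := by
  have e0 := h [] a [a, a, b, b] [] (by simp) rfl
  simp only [List.cons_append, List.nil_append, List.append_nil, h.cube_left] at e0
  simpa using e0

lemma vanish_aabaab (h : KillsPolarizedCubes f) (a b : Bool) : f [a, a, b, a, a, b] = 0 := by
  have e0 := h [] a [a, a, b] [b] (by simp) rfl
  simp only [List.cons_append, List.nil_append, h.cube_left] at e0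
  simpa using e0

lemma vanish_baabaa (h : KillsPolarizedCubes f) (a b : Bool) : f [b, a, a, b, a, a] = 0 := by
  have e0 := h [] b [a, a] [a, a] (by simp) rfl
  simp only [List.cons_append, List.nil_append, h.cube_mid', h.vanish_aabbaa a b] at e0
  simpa using e0

lemma vanish_abaaba (h : KillsPolarizedCubes f) (a b : Bool) : f [a, b, a, a, b, a] = 0 := by
  have e0 := h [] a [b, a, a, b] [] (by simp) rfl
  simp only [List.cons_append, List.nil_append, List.append_nil, h.vanish_aabaab a b,
    h.vanish_baabaa a b] at e0
  simpa using e0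

lemma vanish_aababa (h : KillsPolarizedCubes f) (a b : Bool) : f [a, a, b, a, b, a] = 0 := by
  have e0 := h [] a [a, b] [b, a] (by simp) rfl
  simp only [List.cons_append, List.nil_append, h.cube_left, h.vanish_abaaba a b] at e0
  simpa using e0

lemma vanish_ababaa (h : KillsPolarizedCubes f) (a b : Bool) : f [a, b, a, b, a, a] = 0 := by
  have e0 := h [] a [a, b, a, b] [] (by simp) rfl
  simp only [List.cons_append, List.nil_append, List.append_nil, h.cube_left,
    h.vanish_aababa a b] at e0
  simpa using e0

lemma vanish_aabbab (h : KillsPolarizedCubes f) (a b : Bool) : f [a, a, b, b, a, b] = 0 := by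
  have e0 := h [] a [a, b, b] [b] (by simp) rfl
  simp only [List.cons_append, List.nil_append, h.cube_left, h.vanish_abbaab a b] at e0
  simpa using e0

lemma vanish_abbaba (h : KillsPolarizedCubes f) (a b : Bool) : f [a, b, b, a, b, a] = 0 := by
  have e0 := h [] a [b, b, a, b] [] (by simp) rfl
  simp only [List.cons_append, List.nil_append, List.append_nil, h.vanish_aabbab a b,
    h.vanish_bbabaa a b] at e0
  simpa using e0

lemma vanish (h : KillsPolarizedCubes f) (l : List Bool) (hl : l.length = 6) : f l = 0 := by
  match l, hl with
  | [x0, x1, x2, x3, x4, x5], _ =>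
    cases x0 <;> cases x1 <;> cases x2 <;> cases x3 <;> cases x4 <;> cases x5 <;>
    first
    | exact h.cube_left _ _ _ _
    | exact h.cube_mid _ _ _ _
    | exact h.cube_mid' _ _ _ _
    | exact h.cube_right _ _ _ _
    | exact h.vanish_bababa _ _
    | exact h.vanish_bbabaa _ _
    | exact h.vanish_ababba _ _
    | exact h.vanish_babbaa _ _
    | exact h.vanish_abbaab _ _
    | exact h.vanish_aabbaa _ _
    | exact h.vanish_aabaab _ _
    | exact h.vanish_baabaa _ _
    | exact h.vanish_abaaba _ _
    | exact h.vanish_aababa _ _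
    | exact h.vanish_ababaa _ _
    | exact h.vanish_aabbab _ _
    | exact h.vanish_abbaba _ _

end KillsPolarizedCubes

end NilIndexThree

/-! ### Words up to rotation, and the span of short words -/

section Words

/-- Up to rotation, a binary word of length at most six either is one of eleven words or their
complements, or begins with the cube of a letter. -/
lemma binary_necklace_induction {P : List Bool → Prop} (rotate : ∀ x l, P (l ++ [x]) → P (x :: l))
    (cube : ∀ x l, (∀ l' : List Bool, l'.length < l.length + 3 → P l') → P (x :: x :: x :: l))
    (nil : P []) (h_x : ∀ x, P [x])
    (h_xx : ∀ x, P [x, x])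
    (h_xy : ∀ x, P [x, !x])
    (h_xxy : ∀ x, P [x, x, !x])
    (h_xxyy : ∀ x, P [x, x, !x, !x])
    (h_xyxy : ∀ x, P [x, !x, x, !x])
    (h_xxyxy : ∀ x, P [x, x, !x, x, !x])
    (h_xxyxxy : ∀ x, P [x, x, !x, x, x, !x])
    (h_xxyxyy : ∀ x, P [x, x, !x, x, !x, !x])
    (h_xxyyxy : ∀ x, P [x, x, !x, !x, x, !x])
    (h_xyxyxy : ∀ x, P [x, !x, x, !x, x, !x]) :
    ∀ l : List Bool, l.length ≤ 6 → P l := by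
  have main : ∀ l : List Bool, l.length ≤ 6 →
      (∀ l' : List Bool, l'.length < l.length → P l') → P l := by
    intro l hl ih
    match l, hl with
    | [], _ => exact nil
    | [x], _ => exact h_x x
    | [x0, x1], _ =>
      -- Rotation is the last alternative, so a word turns only until it reaches a listed
      -- representative or, in the longer cases, an initial cube.
      cases x0 <;> cases x1 <;>
      repeat
        first
        | exact h_xx true
        | exact h_xx false
        | exact h_xy true
        | exact h_xy false
        | refine rotate _ _ ?_
    | [x0, x1, x2], _ =>
      cases x0 <;> cases x1 <;> cases x2 <;>
      repeat
        first
        | exact cube _ _ ih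
        | exact h_xxy true
        | exact h_xxy false
        | refine rotate _ _ ?_
    | [x0, x1, x2, x3], _ =>
      cases x0 <;> cases x1 <;> cases x2 <;> cases x3 <;>
      repeat
        first
        | exact cube _ _ ih
        | exact h_xxyy true
        | exact h_xxyy false
        | exact h_xyxy true
        | exact h_xyxy false
        | refine rotate _ _ ?_
    | [x0, x1, x2, x3, x4], _ =>
      cases x0 <;> cases x1 <;> cases x2 <;> cases x3 <;> cases x4 <;>
      repeat
        first
        | exact cube _ _ ih
        | exact h_xxyxy true
        | exact h_xxyxy false
        | refine rotate _ _ ?_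
    | [x0, x1, x2, x3, x4, x5], _ =>
      cases x0 <;> cases x1 <;> cases x2 <;> cases x3 <;> cases x4 <;> cases x5 <;>
      repeat
        first
        | exact cube _ _ ih
        | exact h_xxyxxy true
        | exact h_xxyxxy false
        | exact h_xxyxyy true
        | exact h_xxyxyy false
        | exact h_xxyyxy true
        | exact h_xxyyxy false
        | exact h_xyxyxy true
        | exact h_xyxyxy false
        | refine rotate _ _ ?_
  intro l
  induction hn : l.length using Nat.strong_induction_on generalizing l with
  | _ n ih =>
    subst hn
    exact fun hl => main l hl fun l' hl' => ih l'.length hl' l' rfl (by omega)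

variable {S : Type*} [CommRing S]

/-- The product of the matrices `M x` along a word in the letters `x : Bool`. -/
def wordProd (M : Bool → Matrix (Fin 3) (Fin 3) S) (l : List Bool) : Matrix (Fin 3) (Fin 3) S :=
  (l.map M).prod

variable {M M' : Bool → Matrix (Fin 3) (Fin 3) S}

lemma wordProd_append (l₁ l₂ : List Bool) :
    wordProd M (l₁ ++ l₂) = wordProd M l₁ * wordProd M l₂ := by
  simp [wordProd]

lemma wordProd_cons (x : Bool) (l : List Bool) : wordProd M (x :: l) = M x * wordProd M l := by
  simp [wordProd]

variable [Algebra ℂ S]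

/-- The `T`-span of the products of words of length at most `n`. -/
def wordSpan (T : Subalgebra ℂ S) (M : Bool → Matrix (Fin 3) (Fin 3) S) (n : ℕ) :
    Submodule T (Matrix (Fin 3) (Fin 3) S) :=
  Submodule.span T {X | ∃ l : List Bool, l.length ≤ n ∧ wordProd M l = X}

variable {T : Subalgebra ℂ S}

lemma wordProd_mem_wordSpan {n : ℕ} {l : List Bool} (hl : l.length ≤ n) :
    wordProd M l ∈ wordSpan T M n :=
  Submodule.subset_span ⟨l, hl, rfl⟩

lemma wordSpan_mono {m n : ℕ} (h : m ≤ n) : wordSpan T M m ≤ wordSpan T M n :=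
  Submodule.span_mono fun _ ⟨l, hl, e⟩ => ⟨l, hl.trans h, e⟩

lemma wordProd_mul_mem_wordSpan {n : ℕ} (u : List Bool) {X : Matrix (Fin 3) (Fin 3) S}
    (hX : X ∈ wordSpan T M n) : wordProd M u * X ∈ wordSpan T M (u.length + n) := by
  induction hX using Submodule.span_induction with
  | mem X hX =>
    obtain ⟨l, hl, rfl⟩ := hX
    rw [← wordProd_append]
    exact wordProd_mem_wordSpan (by simp [hl])
  | zero => simp
  | add X Y _ _ hX hY => rw [mul_add]; exact add_mem hX hY
  | smul c X _ hX => rw [mul_smul_comm]; exact Submodule.smul_mem _ _ hX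

lemma mul_wordProd_mem_wordSpan {n : ℕ} (u : List Bool) {X : Matrix (Fin 3) (Fin 3) S}
    (hX : X ∈ wordSpan T M n) : X * wordProd M u ∈ wordSpan T M (n + u.length) := by
  induction hX using Submodule.span_induction with
  | mem X hX =>
    obtain ⟨l, hl, rfl⟩ := hX
    rw [← wordProd_append]
    exact wordProd_mem_wordSpan (by simp [hl])
  | zero => simp
  | add X Y _ _ hX hY => rw [add_mul]; exact add_mem hX hY
  | smul c X _ hX => rw [smul_mul_assoc]; exact Submodule.smul_mem _ _ hX

lemma smul_mem_wordSpan {n : ℕ} {c : S} (hc : c ∈ T) {X : Matrix (Fin 3) (Fin 3) S}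
    (hX : X ∈ wordSpan T M n) : c • X ∈ wordSpan T M n :=
  Submodule.smul_mem _ (⟨c, hc⟩ : T) hX

/-- The traces generating the trace algebra of two unimodular `3 × 3` matrices. -/
def LetterTracesIn (T : Subalgebra ℂ S) (M M' : Bool → Matrix (Fin 3) (Fin 3) S) : Prop :=
  BasicTracesIn T (M false) (M' false) (M true) (M' true)

namespace LetterTracesIn

lemma basic (h : LetterTracesIn T M M') : ∀ x : Bool, BasicTracesIn T (M x) (M' x) (M !x) (M' !x)
  | false => h
  | true => h.swap

lemma trace_rotate {x : Bool} {l : List Bool} (h : (wordProd M (l ++ [x])).trace ∈ T) :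
    (wordProd M (x :: l)).trace ∈ T := by
  rw [wordProd_cons, trace_mul_comm]
  simpa [wordProd] using h

lemma trace_word_x (h : LetterTracesIn T M M') (x : Bool) : (wordProd M [x]).trace ∈ T := by
  simpa [wordProd] using (h.basic x).left.trace_mem

lemma trace_word_xx (h : LetterTracesIn T M M') (x : Bool) :
    (wordProd M [x, x]).trace ∈ T := by
  simpa [wordProd] using (h.basic x).left.trace_sq_mem

lemma trace_word_xy (h : LetterTracesIn T M M') (x : Bool) :
    (wordProd M [x, !x]).trace ∈ T := by
  simpa [wordProd] using (h.basic x).mul_mem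

lemma trace_word_xxy (h : LetterTracesIn T M M') (x : Bool) :
    (wordProd M [x, x, !x]).trace ∈ T := by
  simpa [wordProd] using (h.basic x).trace_xxy

lemma trace_word_xxyy (h : LetterTracesIn T M M') (x : Bool) :
    (wordProd M [x, x, !x, !x]).trace ∈ T := by
  simpa [wordProd] using (h.basic x).trace_xxyy

lemma trace_word_xyxy (h : LetterTracesIn T M M') (x : Bool) :
    (wordProd M [x, !x, x, !x]).trace ∈ T := by
  simpa [wordProd] using (h.basic x).trace_xyxy

lemma trace_word_xxyxy (h : LetterTracesIn T M M') (x : Bool) :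
    (wordProd M [x, x, !x, x, !x]).trace ∈ T := by
  simpa [wordProd] using (h.basic x).trace_xxyxy

lemma trace_word_xxyxxy (h : LetterTracesIn T M M') (x : Bool) :
    (wordProd M [x, x, !x, x, x, !x]).trace ∈ T := by
  simpa [wordProd] using (h.basic x).trace_xxyxxy

lemma trace_word_xxyxyy (h : LetterTracesIn T M M') (x : Bool) :
    (wordProd M [x, x, !x, x, !x, !x]).trace ∈ T := by
  simpa [wordProd] using (h.basic x).trace_xxyxyy

lemma trace_word_xxyyxy (h : LetterTracesIn T M M') (x : Bool) :
    (wordProd M [x, x, !x, !x, x, !x]).trace ∈ T := by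
  simpa [wordProd] using (h.basic x).trace_xxyyxy

lemma trace_word_xyxyxy (h : LetterTracesIn T M M') (x : Bool) :
    (wordProd M [x, !x, x, !x, x, !x]).trace ∈ T := by
  simpa [wordProd] using (h.basic x).trace_xyxyxy

lemma trace_word_cube (h : LetterTracesIn T M M') (x : Bool) (l : List Bool)
    (ih : ∀ l' : List Bool, l'.length < l.length + 3 → (wordProd M l').trace ∈ T) :
    (wordProd M (x :: x :: x :: l)).trace ∈ T := by
  have h0 := ih l (by omega)
  have h1 := ih (x :: l) (by simp)
  have h2 := ih (x :: x :: l) (by simp)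
  simp only [wordProd_cons] at h1 h2 ⊢
  exact (h.basic x).left.trace_cube_mul_mem h0 h1 h2

lemma trace_wordProd_mem (h : LetterTracesIn T M M') (l : List Bool) (hl : l.length ≤ 6) :
    (wordProd M l).trace ∈ T :=
  binary_necklace_induction (P := fun l => (wordProd M l).trace ∈ T)
    (fun _ _ => trace_rotate) h.trace_word_cube UnimodularTraceIn.trace_one_mem
    h.trace_word_x h.trace_word_xx h.trace_word_xy h.trace_word_xxy h.trace_word_xxyy
    h.trace_word_xyxy h.trace_word_xxyxy h.trace_word_xxyxxy
    h.trace_word_xxyxyy h.trace_word_xxyyxy h.trace_word_xyxyxy l hl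

lemma trace_mem_of_mem_wordSpan (h : LetterTracesIn T M M') {X : Matrix (Fin 3) (Fin 3) S}
    (hX : X ∈ wordSpan T M 5) : X.trace ∈ T := by
  induction hX using Submodule.span_induction with
  | mem X hX =>
    obtain ⟨l, hl, rfl⟩ := hX
    exact h.trace_wordProd_mem l (by omega)
  | zero => simp
  | add X Y _ _ hX hY => rw [trace_add]; exact T.add_mem hX hY
  | smul c X _ hX => rw [trace_smul]; exact T.mul_mem c.2 hX

/-- The bound on `w` keeps tr(X²W) within the known degree 6; nonemptiness makes the term X² short
enough for the target span. -/
lemma polarized_mem_wordSpan (h : LetterTracesIn T M M') (x : Bool) (w : List Bool)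
    (hw : w ≠ []) (hl : w.length ≤ 4) :
    wordProd M (x :: x :: w) + wordProd M (x :: w ++ [x]) + wordProd M (w ++ [x, x]) ∈
      wordSpan T M (w.length + 1) := by
  have hw1 : 1 ≤ w.length := List.length_pos_iff.mpr hw
  have key := polarized_cayley_hamilton_fin_three (M x) (wordProd M w)
  rw [adjugate_trace_of_det_eq_one (h.basic x).left.det_eq (h.basic x).left.mul_inv] at key
  have e : wordProd M (x :: x :: w) + wordProd M (x :: w ++ [x]) + wordProd M (w ++ [x, x])
      = M x * M x * wordProd M w + M x * wordProd M w * M x + wordProd M w * M x * M x := by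
    simp [wordProd, mul_assoc]
  have hX := (h.basic x).left.trace_mem
  have hX' := (h.basic x).left.trace_inv_mem
  have hW : (wordProd M w).trace ∈ T := h.trace_wordProd_mem w (by omega)
  have hXW : (M x * wordProd M w).trace ∈ T := by
    rw [← wordProd_cons]
    exact h.trace_wordProd_mem _ (by simp; omega)
  have hXXW : (M x * M x * wordProd M w).trace ∈ T := by
    rw [mul_assoc, ← wordProd_cons, ← wordProd_cons]
    exact h.trace_wordProd_mem _ (by simp; omega)
  have m1 : M x * wordProd M w ∈ wordSpan T M (w.length + 1) := by
    rw [← wordProd_cons]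
    exact wordProd_mem_wordSpan (by simp)
  have m2 : wordProd M w * M x ∈ wordSpan T M (w.length + 1) := by
    have := wordProd_mem_wordSpan (T := T) (M := M) (n := w.length + 1) (l := w ++ [x]) (by simp)
    simpa [wordProd] using this
  have m3 : M x * M x ∈ wordSpan T M (w.length + 1) := by
    have := wordProd_mem_wordSpan (T := T) (M := M) (n := w.length + 1) (l := [x, x])
      (by simp; omega)
    simpa [wordProd] using this
  have m4 : wordProd M w ∈ wordSpan T M (w.length + 1) := wordProd_mem_wordSpan (by simp)
  have m5 : M x ∈ wordSpan T M (w.length + 1) := by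
    have := wordProd_mem_wordSpan (T := T) (M := M) (n := w.length + 1) (l := [x]) (by simp)
    simpa [wordProd] using this
  have m6 : 1 ∈ wordSpan T M (w.length + 1) :=
    wordProd_mem_wordSpan (l := []) (by simp)
  rw [e, key]
  refine add_mem (sub_mem (sub_mem (add_mem (add_mem ?_ ?_) ?_) ?_) ?_) ?_ <;>
    refine smul_mem_wordSpan ?_ (by assumption) <;>
    apply_rules [T.add_mem, T.sub_mem, T.mul_mem]

lemma wordProd_mem_of_length_eq_six (h : LetterTracesIn T M M') (l : List Bool)
    (hl : l.length = 6) : wordProd M l ∈ wordSpan T M 5 := by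
  -- A word outside the span would be detected by a ℂ-linear functional vanishing on the span, which
  -- reduces the claim to scalar functions on words.
  by_contra hcon
  obtain ⟨f, hf, hker⟩ := Submodule.exists_le_ker_of_notMem
    (p := (wordSpan T M 5).restrictScalars ℂ) (v := wordProd M l) hcon
  refine hf (KillsPolarizedCubes.vanish (f := fun l => f (wordProd M l)) ?_ l hl)
  intro u x w v hw hlen
  -- The polarized sum drops one degree, so the total length here is |u| + |w| + 1 + |v| = 5.
  have h1 := wordProd_mul_mem_wordSpan u (mul_wordProd_mem_wordSpan v
    (h.polarized_mem_wordSpan x w hw (by omega)))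
  have h2 : f _ = 0 := hker (wordSpan_mono (by omega) h1)
  simpa only [add_mul, mul_add, map_add, wordProd_append, mul_assoc] using h2

lemma wordSpan_six_le (h : LetterTracesIn T M M') : wordSpan T M 6 ≤ wordSpan T M 5 := by
  refine Submodule.span_le.mpr ?_
  rintro _ ⟨l, hl, rfl⟩
  rcases hl.lt_or_eq with hl | hl
  · exact wordProd_mem_wordSpan (by omega)
  · exact h.wordProd_mem_of_length_eq_six l hl

lemma wordProd_mem (h : LetterTracesIn T M M') (l : List Bool) :
    wordProd M l ∈ wordSpan T M 5 := by
  induction l with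
  | nil => exact wordProd_mem_wordSpan (by simp)
  | cons x l ih =>
    have := wordProd_mul_mem_wordSpan [x] ih
    rw [wordProd_cons]
    exact h.wordSpan_six_le (by simpa [wordProd] using this)

lemma mul_mem (h : LetterTracesIn T M M') {X Y : Matrix (Fin 3) (Fin 3) S}
    (hX : X ∈ wordSpan T M 5) (hY : Y ∈ wordSpan T M 5) : X * Y ∈ wordSpan T M 5 := by
  induction hX, hY using Submodule.span_induction₂ with
  | mem_mem X Y hX hY =>
    obtain ⟨l, -, rfl⟩ := hX
    obtain ⟨l', -, rfl⟩ := hY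
    rw [← wordProd_append]
    exact h.wordProd_mem _
  | zero_left => simp
  | zero_right => simp
  | add_left X Y Z _ _ _ hX hY => rw [add_mul]; exact add_mem hX hY
  | add_right X Y Z _ _ _ hX hY => rw [mul_add]; exact add_mem hX hY
  | smul_left c X Y _ _ hX => rw [smul_mul_assoc]; exact Submodule.smul_mem _ _ hX
  | smul_right c X Y _ _ hX => rw [mul_smul_comm]; exact Submodule.smul_mem _ _ hX

lemma letter_mem (x : Bool) : M x ∈ wordSpan T M 5 := by
  simpa [wordProd] using wordProd_mem_wordSpan (T := T) (M := M) (n := 5) (l := [x]) (by simp)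

/-- Cayley–Hamilton solved for the inverse, so positive words suffice. -/
lemma letter_inv_mem (h : LetterTracesIn T M M') (x : Bool) : M' x ∈ wordSpan T M 5 := by
  have hx := (h.basic x).left
  have e : M' x = M x * M x - (M x).trace • M x
      + (M' x).trace • (1 : Matrix (Fin 3) (Fin 3) S) := by
    rw [sq_eq_of_det_eq_one hx.det_eq hx.mul_inv]
    abel
  rw [e]
  exact add_mem (sub_mem (h.mul_mem (letter_mem x) (letter_mem x))
    (smul_mem_wordSpan hx.trace_mem (letter_mem x)))
    (smul_mem_wordSpan hx.trace_inv_mem (h.wordProd_mem []))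

end LetterTracesIn

end Words

/-! ### The universal pair in SU(2,1) -/

section GenericPair

lemma tr21_mul_comm (A B : SU21) : tr21 (A * B) = tr21 (B * A) := by
  simp only [tr21, Subgroup.coe_mul]
  exact trace_mul_comm _ _

lemma formJ_mul_formJ : formJ * formJ = 1 := by
  rw [formJ, diagonal_mul_diagonal, ← diagonal_one]
  congr 1
  ext i
  fin_cases i <;> simp

/-- Since J² = 1, invariance of the form reads A⁻¹ = J Aᴴ J, and conjugation by J does not change
the trace. -/
lemma tr21_inv (A : SU21) : tr21 A⁻¹ = starRingEnd ℂ (tr21 A) := by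
  have hA : ((A : SpecialLinearGroup (Fin 3) ℂ) : Matrix (Fin 3) (Fin 3) ℂ)ᴴ * formJ *
      ((A : SpecialLinearGroup (Fin 3) ℂ) : Matrix (Fin 3) (Fin 3) ℂ) = formJ := A.2
  have hinv : ((A : SpecialLinearGroup (Fin 3) ℂ) : Matrix (Fin 3) (Fin 3) ℂ) *
      ((A⁻¹ : SU21) : SpecialLinearGroup (Fin 3) ℂ) = 1 :=
    congrArg (fun B : SU21 => B.1.1) (mul_inv_cancel A)
  simp only [tr21]
  generalize (((A⁻¹ : SU21) : SpecialLinearGroup (Fin 3) ℂ) : Matrix (Fin 3) (Fin 3) ℂ) = C at *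
  generalize ((A : SpecialLinearGroup (Fin 3) ℂ) : Matrix (Fin 3) (Fin 3) ℂ) = M at *
  have hleft : (formJ * Mᴴ * formJ) * M = 1 := by
    rw [mul_assoc formJ, mul_assoc formJ, hA, formJ_mul_formJ]
  have hC : C = formJ * Mᴴ * formJ := by
    rw [← mul_one (formJ * Mᴴ * formJ), ← hinv, ← mul_assoc, hleft, one_mul]
  rw [hC, trace_mul_comm, ← mul_assoc, formJ_mul_formJ, one_mul, trace_conjTranspose]
  rfl

/-- A family of elements of `SU(2,1)` as a matrix of functions on the index set. -/
def matrixOfFamily {ι : Type*} (g : ι → SU21) : Matrix (Fin 3) (Fin 3) (ι → ℂ) :=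
  Matrix.of fun i j p => ((g p : SpecialLinearGroup (Fin 3) ℂ) : Matrix (Fin 3) (Fin 3) ℂ) i j

variable {ι : Type*}

lemma matrixOfFamily_one : matrixOfFamily (1 : ι → SU21) = 1 := by
  ext i j p
  by_cases h : i = j <;> simp [matrixOfFamily, one_apply, h]

lemma matrixOfFamily_mul (g h : ι → SU21) :
    matrixOfFamily (g * h) = matrixOfFamily g * matrixOfFamily h := by
  ext i j p
  simp [matrixOfFamily, mul_apply]

lemma matrixOfFamily_trace (g : ι → SU21) : (matrixOfFamily g).trace = fun p => tr21 (g p) := by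
  ext p
  simp [matrixOfFamily, tr21, Matrix.trace]

lemma matrixOfFamily_det (g : ι → SU21) : (matrixOfFamily g).det = 1 := by
  ext p
  have h := RingHom.map_det (Pi.evalRingHom (fun _ : ι => ℂ) p) (matrixOfFamily g)
  rw [Pi.evalRingHom_apply] at h
  rw [h]
  exact (g p : SpecialLinearGroup (Fin 3) ℂ).2

lemma matrixOfFamily_mul_inv (g : ι → SU21) : matrixOfFamily g * matrixOfFamily g⁻¹ = 1 := by
  rw [← matrixOfFamily_mul, mul_inv_cancel, matrixOfFamily_one]

/-- The five basic traces and their conjugates as functions on pairs of elements of `SU(2,1)`. -/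
def basicTraceFunction (k : Fin 5 ⊕ Fin 5) (p : SU21 × SU21) : ℂ :=
  Sum.elim (fiveTraces p.1 p.2) (fun i => starRingEnd ℂ (fiveTraces p.1 p.2 i)) k

/-- The algebra of functions on pairs generated by the five basic traces and their conjugates. -/
def basicTraceAlgebra : Subalgebra ℂ (SU21 × SU21 → ℂ) :=
  Algebra.adjoin ℂ (Set.range basicTraceFunction)

lemma basicTraceFunction_mem (k : Fin 5 ⊕ Fin 5) : basicTraceFunction k ∈ basicTraceAlgebra :=
  Algebra.subset_adjoin ⟨k, rfl⟩

lemma tr21_mem_of_eq_five (g : SU21 × SU21 → SU21) (i : Fin 5)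
    (h : ∀ p, tr21 (g p) = fiveTraces p.1 p.2 i) :
    (matrixOfFamily g).trace ∈ basicTraceAlgebra := by
  rw [matrixOfFamily_trace, funext h]
  exact basicTraceFunction_mem (Sum.inl i)

lemma tr21_mem_of_inv_eq_five (g : SU21 × SU21 → SU21) (i : Fin 5)
    (h : ∀ p, tr21 (g p)⁻¹ = fiveTraces p.1 p.2 i) :
    (matrixOfFamily g).trace ∈ basicTraceAlgebra := by
  have e : ∀ p, tr21 (g p) = starRingEnd ℂ (fiveTraces p.1 p.2 i) := fun p => by
    rw [← h p, ← tr21_inv, inv_inv]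
  rw [matrixOfFamily_trace, funext e]
  exact basicTraceFunction_mem (Sum.inr i)

/-- The two coordinate families on pairs. -/
def pairLetter : Bool → SU21 × SU21 → SU21
  | false => Prod.fst
  | true => Prod.snd

lemma letterTracesIn_basicTraceAlgebra : LetterTracesIn basicTraceAlgebra
    (fun x => matrixOfFamily (pairLetter x)) (fun x => matrixOfFamily (pairLetter x)⁻¹) where
  left := ⟨matrixOfFamily_det _, matrixOfFamily_mul_inv _,
    tr21_mem_of_eq_five _ 0 fun _ => rfl,
    tr21_mem_of_inv_eq_five _ 0 fun p => congrArg tr21 (inv_inv p.1)⟩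
  right := ⟨matrixOfFamily_det _, matrixOfFamily_mul_inv _,
    tr21_mem_of_eq_five _ 1 fun _ => rfl,
    tr21_mem_of_inv_eq_five _ 1 fun p => congrArg tr21 (inv_inv p.2)⟩
  mul_mem := by
    rw [← matrixOfFamily_mul]
    exact tr21_mem_of_eq_five _ 2 fun _ => rfl
  inv_mul_inv_mem := by
    rw [← matrixOfFamily_mul]
    refine tr21_mem_of_inv_eq_five _ 2 fun p => ?_
    change tr21 (p.1⁻¹ * p.2⁻¹)⁻¹ = tr21 (p.1 * p.2)
    rw [tr21_mul_comm p.1]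
    group
  inv_mul_mem := by
    rw [← matrixOfFamily_mul]
    exact tr21_mem_of_eq_five _ 3 fun _ => rfl
  mul_inv_mem := by
    rw [← matrixOfFamily_mul]
    refine tr21_mem_of_inv_eq_five _ 3 fun p => ?_
    change tr21 (p.1 * p.2⁻¹)⁻¹ = tr21 (p.1⁻¹ * p.2)
    rw [tr21_mul_comm p.1⁻¹]
    group
  comm_mem := by
    simp only [← matrixOfFamily_mul]
    refine tr21_mem_of_eq_five _ 4 fun p => ?_
    change tr21 (p.1 * (p.2 * (p.1⁻¹ * p.2⁻¹))) = tr21 (p.1 * p.2 * p.1⁻¹ * p.2⁻¹)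
    simp only [mul_assoc]
  comm_mem' := by
    simp only [← matrixOfFamily_mul]
    refine tr21_mem_of_inv_eq_five _ 4 fun p => ?_
    change tr21 (p.2 * (p.1 * (p.2⁻¹ * p.1⁻¹)))⁻¹ = tr21 (p.1 * p.2 * p.1⁻¹ * p.2⁻¹)
    group

lemma matrixOfFamily_lift_mem (w : FreeGroup (Fin 2)) :
    matrixOfFamily (fun p : SU21 × SU21 => FreeGroup.lift ![p.1, p.2] w) ∈
      wordSpan basicTraceAlgebra (fun x => matrixOfFamily (pairLetter x)) 5 := by
  have h := letterTracesIn_basicTraceAlgebra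
  induction w using FreeGroup.induction_on with
  | C1 =>
    simp only [map_one]
    exact (matrixOfFamily_one (ι := SU21 × SU21)) ▸ h.wordProd_mem []
  | of i =>
    simp only [FreeGroup.lift_apply_of]
    fin_cases i
    · exact LetterTracesIn.letter_mem false
    · exact LetterTracesIn.letter_mem true
  | inv_of i _ =>
    simp only [map_inv, FreeGroup.lift_apply_of]
    fin_cases i
    · exact h.letter_inv_mem false
    · exact h.letter_inv_mem true
  | mul v w hv hw =>
    simp only [map_mul]
    have := h.mul_mem hv hw
    rwa [← matrixOfFamily_mul] at this

end GenericPair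

theorem proposition2p2 (w : FreeGroup (Fin 2)) :
    ∃ P : MvPolynomial (Fin 5 ⊕ Fin 5) ℂ, ∀ A B : SU21,
      tr21 (FreeGroup.lift ![A, B] w) =
        MvPolynomial.eval
          (Sum.elim (fiveTraces A B) (fun i => starRingEnd ℂ (fiveTraces A B i))) P := by
  have hmem := letterTracesIn_basicTraceAlgebra.trace_mem_of_mem_wordSpan
    (matrixOfFamily_lift_mem w)
  -- The generated algebra is the image of the polynomial ring, which supplies `P`; evaluation at a
  -- pair is an algebra map and so commutes with substitution into `P`.
  rw [matrixOfFamily_trace, basicTraceAlgebra, Algebra.adjoin_range_eq_range_aeval] at hmem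
  obtain ⟨P, hP⟩ := hmem
  refine ⟨P, fun A B => ?_⟩
  have e := congrFun hP (A, B)
  refine e.symm.trans ?_
  have hcomp : (Pi.evalAlgHom ℂ (fun _ : SU21 × SU21 => ℂ) (A, B)).comp
      (MvPolynomial.aeval basicTraceFunction) =
      MvPolynomial.aeval (fun k => basicTraceFunction k (A, B)) :=
    MvPolynomial.algHom_ext fun k => by simp
  exact congrArg (fun φ => φ P) hcomp
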